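/- Let $(\Omega,\mathcal F,(\mathcal F_t)_{t\ge0})$ be a filtered measurable space (the filtration is not assumed to be right-continuous or completed) and let $P$, $Q$ be probability measures on $\mathcal F$. Let $(M_t)_{t\ge0}$ be an $(\mathcal F_t)$-adapted process with continuous paths and values in $\mathbb R^+$, which is a martingale under $P$, with $M_0=1$ $P$-a.s., and suppose that $$Q|_{\mathcal F_t}=M_t\cdot P|_{\mathcal F_t}\qquad\text{for every } t\ge 0 .$$ Put $T_0=\inf\{t\ge 0: M_t=0\}$ (with $\inf\emptyset=\infty$) and $\gamma=\sup\{t<T_0: M_t=1\}$, and assume that $T_0<\infty$ $P$-a.s. Define $M'_t=\dfrac{1_{\{t<T_0\}}}{M_t}$ (equal to $0$ when $t\ge T_0$). Then: 1. $Q$-a.s., $M_t>0$ and $M'_t>0$ for all $t\ge0$; that is, $M'$ is well defined and strictly positive under $Q$. 2. Under $Q$, $(M'_t)$ belongs to the class $\mathcal L_0^{(+)}$ of nonnegative local martingales which start from a positive constant, have a.s. continuous paths, and satisfy $\lim_{t\to\infty}M'_t=0$ a.s. 3. $(M'_t)$ is a strict local martingale under $Q$, i.e. a local martingale which is not a martingale.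 4. For every $t\ge 0$ and every $\mathcal F_t$-measurable random variable $F_t$ which is either bounded and real-valued or $[0,\infty]$-valued, $$E_Q\left[F_t\,(M'_t-1)^+\right]=E_P\left[F_t\,1_{\{\gamma\le t<T_0\}}\right];$$ if $F_t$ is bounded, both integrands are integrable. -/

import Mathlib

open MeasureTheory ProbabilityTheory Filter Topology
open scoped NNReal ENNReal

namespace StrictLocal

variable {Ω : Type*} {mΩ : MeasurableSpace Ω}

/-- `X` is a local martingale: along some localizing sequence of stopping times `τ n`
(a.s. nondecreasing to infinity), the processes `1_{τ n > 0} X^{τ n}` are martingales. -/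
def IsLocalMartingale (X : ℝ≥0 → Ω → ℝ) (𝓕 : Filtration ℝ≥0 mΩ) (μ : Measure Ω) : Prop :=
  Locally (fun Y => Martingale Y 𝓕 μ) 𝓕 X μ

/-- A strict local martingale is a local martingale which is not a true martingale. -/
def IsStrictLocalMartingale (X : ℝ≥0 → Ω → ℝ) (𝓕 : Filtration ℝ≥0 mΩ) (μ : Measure Ω) : Prop :=
  IsLocalMartingale X 𝓕 μ ∧ ¬ Martingale X 𝓕 μ

/-- The class of nonnegative continuous local martingales, starting from a positive constant,
which converge a.s. to `0` at infinity. Path properties hold up to a null set. -/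
structure ClassLZeroPlus (X : ℝ≥0 → Ω → ℝ) (𝓕 : Filtration ℝ≥0 mΩ) (μ : Measure Ω) : Prop where
  isLocalMartingale : IsLocalMartingale X 𝓕 μ
  nonneg : ∀ᵐ ω ∂μ, ∀ t, 0 ≤ X t ω
  continuous : ∀ᵐ ω ∂μ, Continuous fun t => X t ω
  init : ∃ a : ℝ, 0 < a ∧ ∀ᵐ ω ∂μ, X 0 ω = a
  tendsto_zero : ∀ᵐ ω ∂μ, Tendsto (fun t => X t ω) atTop (𝓝 0)

/-- `T₀ = inf {t ≥ 0 : M_t = 0}`, equal to `⊤` when `M` does not vanish. -/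
noncomputable def hitZero (M : ℝ≥0 → Ω → ℝ) : Ω → WithTop ℝ≥0 :=
  hittingAfter M {0} 0

/-- `γ = sup {t < T₀ : M_t = 1}`, with values in `[0, ∞]`. -/
noncomputable def lastOne (M : ℝ≥0 → Ω → ℝ) (ω : Ω) : WithTop ℝ≥0 :=
  sSup ((fun t : ℝ≥0 => (t : WithTop ℝ≥0)) '' {t : ℝ≥0 | (t : WithTop ℝ≥0) < hitZero M ω ∧ M t ω = 1})

/-- The process `M'_t = 1_{t < T₀} / M_t`. -/
noncomputable def recipProcess (M : ℝ≥0 → Ω → ℝ) (t : ℝ≥0) : Ω → ℝ :=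
  {ω | (t : WithTop ℝ≥0) < hitZero M ω}.indicator fun ω => 1 / M t ω

/-- The event `{γ ≤ t < T₀}`. -/
def betweenEvent (M : ℝ≥0 → Ω → ℝ) (t : ℝ≥0) : Set Ω :=
  {ω | lastOne M ω ≤ (t : WithTop ℝ≥0) ∧ (t : WithTop ℝ≥0) < hitZero M ω}

end StrictLocal

/-!
The probability `Q` has the continuous density `M_t` with respect to `P` on each `𝓕 t`. Summing
over the values of a discrete stopping time, this change of measure extends to bounded stopping
times `σ`, and by continuity of the paths to all of them, as long as the integrand is a bounded
function of `M_σ` whose product with `M_σ` is bounded too. The integrand `1 / max M_σ c`, with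
`c > 0`, suffices (`IsLocalDensity.setLIntegral_inv_max`): every property of `M` under `P` or `Q`
used below is a consequence of this identity.

* At the first time `σ` after `t` when `M ≤ c`, it yields the maximal inequality
  `Q (∃ u ≥ t, M_u ≤ c) ≤ c P (t < T₀)` (`IsLocalDensity.measure_exists_le`). With the crude bound
  `1` in place of `P (t < T₀)` it implies that `M > 0` under `Q`, hence that `M` stays at `0` after
  `T₀` under `P`. As `P (t < T₀) → 0`, it also implies that `M` tends to infinity under `Q`.
* If `M ≥ c` up to `σ`, the identity reads `∫_B 1 / M_σ ∂Q = P B`, the martingale property of the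
  reciprocal process stopped at the time when `M` reaches `c`
  (`IsLocalDensity.martingale_stopped_recip`). The reciprocal process itself is not a martingale,
  because its expectation at time `t` is `P (t < T₀)`, which tends to `0`.
* With `c = 1` and `σ` the minimum of `T` and of the first time after `s` when `M ≥ 1`, letting `T`
  tend to infinity gives `P (∃ u ≥ s, M_u ≥ 1 | 𝓕 s) = min M_s 1`, because `M` vanishes eventually
  under `P`; then `s` decreases to `t` (`IsLocalDensity.measure_inter_exists_gt`). Up to a null set,
  `γ ≤ t < T₀` means that `t < T₀` and that `M < 1` after `t`. So this event has conditional
  probability `(1 - M_t)^+` on `{t < T₀}`, and `M_t (1 / M_t - 1)^+ = (1 - M_t)^+` turns this into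
  an expectation under `Q`.
-/

namespace StrictLocal

/-! ### Hitting times of closed sets by continuous processes -/

section Hitting

variable {Ω β : Type*} {mΩ : MeasurableSpace Ω} {u : ℝ≥0 → Ω → β} {C : Set β} {s t : ℝ≥0} {ω : Ω}

lemma hittingAfter_lt_top_iff : hittingAfter u C s ω < ⊤ ↔ ∃ v, s ≤ v ∧ u v ω ∈ C := by
  rw [lt_top_iff_ne_top, ne_eq, hittingAfter_eq_top_iff]
  push Not
  rfl

/-- A continuous path attains a closed set at its hitting time. -/
lemma hittingAfter_le_coe_iff [TopologicalSpace β] (hu : Continuous fun t => u t ω)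
    (hC : IsClosed C) :
    hittingAfter u C s ω ≤ (t : WithTop ℝ≥0) ↔ ∃ v ∈ Set.Icc s t, u v ω ∈ C := by
  refine ⟨fun h => ?_, ?_⟩
  · have hlt : hittingAfter u C s ω < ⊤ := h.trans_lt (WithTop.coe_lt_top t)
    have hex := hittingAfter_lt_top_iff.1 hlt
    rw [hittingAfter, if_pos hex, WithTop.coe_le_coe] at h
    have hcl : IsClosed {i : ℝ≥0 | s ≤ i ∧ u i ω ∈ C} := isClosed_Ici.inter (hC.preimage hu)
    have hmem := hcl.csInf_mem hex (OrderBot.bddBelow _)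
    exact ⟨_, ⟨hmem.1, h⟩, hmem.2⟩
  · rintro ⟨v, hv, hvC⟩
    exact (hittingAfter_le_of_mem hv.1 hvC).trans (WithTop.coe_le_coe.2 hv.2)

/-- Right-continuity of the filtration is not needed: by compactness, the path enters `C` during
`[s, t]` if and only if its distance to `C` is arbitrarily small on a countable dense set. -/
lemma isStoppingTime_hittingAfter_of_isClosed [PseudoEMetricSpace β] {𝓕 : Filtration ℝ≥0 mΩ}
    (hadp : StronglyAdapted 𝓕 u) (hu : ∀ ω, Continuous fun t => u t ω) (hC : IsClosed C)
    (s : ℝ≥0) : IsStoppingTime 𝓕 (hittingAfter u C s) := by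
  intro t
  simp_rw [hittingAfter_le_coe_iff (hu _) hC]
  rcases lt_or_ge t s with hts | hst
  · simp [Set.Icc_eq_empty hts.not_ge]
  set q : ℝ≥0 → ℝ≥0 := fun x => max s (min t x) with hq
  have hqc : Continuous q := by fun_prop
  have hq_mem : ∀ x, q x ∈ Set.Icc s t := fun x =>
    ⟨le_max_left _ _, max_le hst (min_le_left _ _)⟩
  have hgc : ∀ ω, Continuous fun v => Metric.infEDist (u v ω) C := fun ω =>
    Metric.continuous_infEDist.comp (hu ω)
  have hset : {ω | ∃ v ∈ Set.Icc s t, u v ω ∈ C} =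
      ⋂ k : ℕ, ⋃ n : ℕ, {ω | Metric.infEDist (u (q (TopologicalSpace.denseSeq ℝ≥0 n)) ω) C
        < ((k : ℝ≥0∞) + 1)⁻¹} := by
    ext ω
    simp only [Set.mem_ofPred_eq, Set.mem_iInter, Set.mem_iUnion]
    constructor
    · rintro ⟨v, hv, hvC⟩ k
      have hopen : IsOpen {x : ℝ≥0 | Metric.infEDist (u (q x) ω) C < ((k : ℝ≥0∞) + 1)⁻¹} :=
        isOpen_lt ((hgc ω).comp hqc) continuous_const
      have hne : v ∈ {x : ℝ≥0 | Metric.infEDist (u (q x) ω) C < ((k : ℝ≥0∞) + 1)⁻¹} := by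
        have : q v = v := by simp [hq, hv.1, hv.2]
        simp only [Set.mem_ofPred_eq, this, Metric.infEDist_zero_of_mem hvC]
        simp
      exact (TopologicalSpace.denseRange_denseSeq ℝ≥0).exists_mem_open hopen ⟨v, hne⟩
    · intro h
      obtain ⟨v, hv, hmin⟩ := (isCompact_Icc (a := s) (b := t)).exists_isMinOn
        (Set.nonempty_Icc.2 hst) (hgc ω).continuousOn
      refine ⟨v, hv, ?_⟩
      have hle : ∀ k : ℕ, Metric.infEDist (u v ω) C ≤ ((k : ℝ≥0∞) + 1)⁻¹ := fun k => by
        obtain ⟨n, hn⟩ := h k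
        exact (hmin (hq_mem _)).trans hn.le
      have h0 : Metric.infEDist (u v ω) C = 0 := by
        have hlim : Tendsto (fun k : ℕ => ((k : ℝ≥0∞) + 1)⁻¹) atTop (𝓝 0) := by
          have := ENNReal.tendsto_inv_nat_nhds_zero.comp (tendsto_add_atTop_nat 1)
          simpa [Function.comp_def] using this
        exact le_antisymm (ge_of_tendsto' hlim hle) bot_le
      rwa [← hC.closure_eq, Metric.mem_closure_iff_infEDist_zero]
  rw [hset]
  refine MeasurableSet.iInter fun k => MeasurableSet.iUnion fun n => ?_
  have hsm := ((hadp (q (TopologicalSpace.denseSeq ℝ≥0 n))).mono (𝓕.mono (hq_mem _).2))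
  exact ((Metric.continuous_infEDist.comp_stronglyMeasurable hsm).measurable)
    measurableSet_Iio

end Hitting

/-! ### Truncated stopping times -/

section Truncation

variable {Ω β : Type*} {mΩ : MeasurableSpace Ω} {u : ℝ≥0 → Ω → β} {C : Set β} {s t : ℝ≥0} {ω : Ω}
  {𝓕 : Filtration ℝ≥0 mΩ} {τ : Ω → WithTop ℝ≥0}

/-- The finite stopping time `min t τ`, in the form in which it enters `stoppedProcess`. -/
noncomputable def truncTime (τ : Ω → WithTop ℝ≥0) (t : ℝ≥0) (ω : Ω) : ℝ≥0 :=
  (min (t : WithTop ℝ≥0) (τ ω)).untopA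

lemma coe_truncTime (τ : Ω → WithTop ℝ≥0) (t : ℝ≥0) (ω : Ω) :
    (truncTime τ t ω : WithTop ℝ≥0) = min (t : WithTop ℝ≥0) (τ ω) := by
  rw [truncTime, WithTop.untopA_eq_untop ((min_le_left _ _).trans_lt (WithTop.coe_lt_top t)).ne,
    WithTop.coe_untop]

lemma truncTime_le (τ : Ω → WithTop ℝ≥0) (t : ℝ≥0) (ω : Ω) : truncTime τ t ω ≤ t := by
  rw [← WithTop.coe_le_coe, coe_truncTime]
  exact min_le_left _ _

lemma coe_truncTime_le (τ : Ω → WithTop ℝ≥0) (t : ℝ≥0) (ω : Ω) :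
    (truncTime τ t ω : WithTop ℝ≥0) ≤ τ ω := by
  rw [coe_truncTime]
  exact min_le_right _ _

lemma le_truncTime (hst : s ≤ t) (hs : (s : WithTop ℝ≥0) ≤ τ ω) : s ≤ truncTime τ t ω := by
  rw [← WithTop.coe_le_coe, coe_truncTime]
  exact le_min (WithTop.coe_le_coe.2 hst) hs

lemma measurableSet_truncTime_le (hτ : IsStoppingTime 𝓕 τ) (t r : ℝ≥0) :
    MeasurableSet[𝓕 r] {ω | truncTime τ t ω ≤ r} := by
  have : {ω | truncTime τ t ω ≤ r} = {_ω | t ≤ r} ∪ {ω | τ ω ≤ r} := by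
    ext ω
    simp only [Set.mem_ofPred_eq, Set.mem_union]
    rw [← WithTop.coe_le_coe, coe_truncTime, min_le_iff, WithTop.coe_le_coe]
  rw [this]
  exact (@MeasurableSet.const _ (𝓕 r) _).union (hτ r)

lemma mem_of_hittingAfter_eq_coe [TopologicalSpace β] (hu : Continuous fun t => u t ω)
    (hC : IsClosed C) (ht : hittingAfter u C s ω = t) : u t ω ∈ C := by
  obtain ⟨v, hv, hvC⟩ := (hittingAfter_le_coe_iff hu hC).1 ht.le
  have : t ≤ v := by
    rw [← WithTop.coe_le_coe, ← ht]
    exact hittingAfter_le_of_mem hv.1 hvC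
  rwa [le_antisymm this hv.2]

lemma mem_of_hittingAfter_le [TopologicalSpace β] (hu : Continuous fun t => u t ω)
    (hC : IsClosed C) (ht : hittingAfter u C s ω ≤ t) :
    u (truncTime (hittingAfter u C s) t ω) ω ∈ C :=
  mem_of_hittingAfter_eq_coe hu hC (by rw [coe_truncTime, min_eq_right ht])

/-- Up to and including its hitting time of `C`, a continuous path remains in any closed set which
contains its starting point and the complement of `C`. -/
lemma mem_of_le_hittingAfter [TopologicalSpace β] (hu : Continuous fun t => u t ω) {K : Set β}
    (hK : IsClosed K) (hCK : ∀ x ∉ C, x ∈ K) (hs : u s ω ∈ K) (hst : s ≤ t)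
    (ht : (t : WithTop ℝ≥0) ≤ hittingAfter u C s ω) : u t ω ∈ K := by
  rcases hst.eq_or_lt with rfl | hlt
  · exact hs
  have : (𝓝[<] t).NeBot := nhdsLT_neBot_of_exists_lt ⟨s, hlt⟩
  refine hK.mem_of_tendsto
    ((hu.tendsto t).mono_left (nhdsWithin_le_nhds (s := Set.Iio t))) ?_
  filter_upwards [Ioo_mem_nhdsLT hlt] with v hv
  exact hCK _ (notMem_of_lt_hittingAfter ((WithTop.coe_lt_coe.2 hv.2).trans_le ht) hv.1.le)

end Truncation

/-! ### Change of measure at bounded stopping times -/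

/-- `M` is a continuous nonnegative adapted process and is, at each time `t`, a density of `Q` with
respect to `P` on `𝓕 t`. -/
structure IsLocalDensity {Ω : Type*} {mΩ : MeasurableSpace Ω} (P Q : Measure Ω)
    (𝓕 : Filtration ℝ≥0 mΩ) (M : ℝ≥0 → Ω → ℝ) : Prop where
  adapted : StronglyAdapted 𝓕 M
  cont : ∀ ω, Continuous fun t => M t ω
  nonneg : ∀ t ω, 0 ≤ M t ω
  apply_eq : ∀ (t : ℝ≥0) (A : Set Ω), MeasurableSet[𝓕 t] A →
    Q A = ∫⁻ ω in A, ENNReal.ofReal (M t ω) ∂P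

variable {Ω : Type*} {mΩ : MeasurableSpace Ω} {P Q : Measure Ω}
  {𝓕 : Filtration ℝ≥0 mΩ} {M : ℝ≥0 → Ω → ℝ}

namespace IsLocalDensity

lemma measurable (h : IsLocalDensity P Q 𝓕 M) (t : ℝ≥0) : Measurable (M t) :=
  ((h.adapted t).mono (𝓕.le t)).measurable

lemma lintegral_eq (h : IsLocalDensity P Q 𝓕 M) (t : ℝ≥0) {f : Ω → ℝ≥0∞}
    (hf : Measurable[𝓕 t] f) :
    ∫⁻ ω, f ω ∂Q = ∫⁻ ω, ENNReal.ofReal (M t ω) * f ω ∂P := by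
  have htrim : Q.trim (𝓕.le t) =
      (P.withDensity fun ω => ENNReal.ofReal (M t ω)).trim (𝓕.le t) := by
    refine @Measure.ext _ (𝓕 t) _ _ fun A hA => ?_
    rw [trim_measurableSet_eq _ hA, trim_measurableSet_eq _ hA,
      withDensity_apply _ (𝓕.le t _ hA), h.apply_eq t A hA]
  rw [← lintegral_trim (𝓕.le t) hf, htrim, lintegral_trim (𝓕.le t) hf,
    lintegral_withDensity_eq_lintegral_mul _ (h.measurable t).ennreal_ofReal
      (hf.mono (𝓕.le t) le_rfl)]
  rfl

lemma setLIntegral_eq (h : IsLocalDensity P Q 𝓕 M) (t : ℝ≥0) {f : Ω → ℝ≥0∞}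
    (hf : Measurable[𝓕 t] f) {A : Set Ω} (hA : MeasurableSet[𝓕 t] A) :
    ∫⁻ ω in A, f ω ∂Q = ∫⁻ ω in A, ENNReal.ofReal (M t ω) * f ω ∂P := by
  have hA' := 𝓕.le t _ hA
  rw [← lintegral_indicator hA', ← lintegral_indicator hA',
    h.lintegral_eq t (hf.indicator hA)]
  refine lintegral_congr fun ω => ?_
  by_cases hω : ω ∈ A <;> simp [hω]

end IsLocalDensity

/-- The approximation of `v ≤ t` from above by points of the grid `{j / (n + 1)} ∪ {t}`. -/
noncomputable def gridApprox (t : ℝ≥0) (n : ℕ) (v : ℝ≥0) : ℝ≥0 :=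
  min t (⌈v * (n + 1)⌉₊ / (n + 1))

lemma tendsto_gridApprox {t v : ℝ≥0} (hv : v ≤ t) :
    Tendsto (fun n => gridApprox t n v) atTop (𝓝 v) := by
  have hpos : ∀ n : ℕ, (0 : ℝ≥0) < n + 1 := fun n => by positivity
  have hlim : Tendsto (fun n : ℕ => v + 1 / ((n : ℝ≥0) + 1)) atTop (𝓝 v) := by
    simpa using tendsto_const_nhds.add (tendsto_one_div_add_atTop_nhds_zero_nat (𝕜 := ℝ≥0))
  refine tendsto_of_tendsto_of_tendsto_of_le_of_le tendsto_const_nhds hlim (fun n => ?_)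
    fun n => ?_
  · exact le_min hv ((le_div_iff₀ (hpos n)).2 (Nat.le_ceil _))
  · refine (min_le_right _ _).trans ?_
    rw [div_le_iff₀ (hpos n), add_mul, one_div, inv_mul_cancel₀ (hpos n).ne']
    exact (Nat.ceil_lt_add_one bot_le).le

lemma measurableSet_inter_ceil_eq {s t : ℝ≥0} {v : Ω → ℝ≥0}
    (hv : ∀ r, MeasurableSet[𝓕 r] {ω | v ω ≤ r}) (hvt : ∀ ω, v ω ≤ t) {B : Set Ω}
    (hB : MeasurableSet[𝓕 s] B) (hsv : ∀ ω ∈ B, s ≤ v ω) (n j : ℕ) :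
    MeasurableSet[𝓕 (min t (j / (n + 1)))] (B ∩ {ω | ⌈v ω * (n + 1)⌉₊ = j}) := by
  have hpos : (0 : ℝ≥0) < (n : ℝ≥0) + 1 := by positivity
  rcases lt_or_ge (min t ((j : ℝ≥0) / (n + 1))) s with hlt | hge
  · have : B ∩ {ω | ⌈v ω * (n + 1)⌉₊ = j} = ∅ := by
      refine Set.eq_empty_of_forall_notMem fun ω ⟨hωB, hωj⟩ => hlt.not_ge ?_
      refine (hsv ω hωB).trans (le_min (hvt ω) ?_)
      rw [le_div_iff₀ hpos]
      exact (Nat.le_ceil _).trans (by exact_mod_cast (le_of_eq hωj))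
    rw [this]
    exact @MeasurableSet.empty _ (𝓕 _)
  · have hle : ∀ i ≤ j, MeasurableSet[𝓕 (min t (j / (n + 1)))]
        {ω | ⌈v ω * (n + 1)⌉₊ ≤ i} := fun i hi => by
      have heq : {ω | ⌈v ω * (n + 1)⌉₊ ≤ i} = {ω | v ω ≤ min t ((i : ℝ≥0) / (n + 1))} := by
        ext ω
        simp only [Set.mem_ofPred_eq, Nat.ceil_le, le_min_iff, hvt ω, true_and, le_div_iff₀ hpos]
      rw [heq]
      refine 𝓕.mono ?_ _ (hv (min t ((i : ℝ≥0) / (n + 1))))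
      gcongr
    refine (𝓕.mono hge _ hB).inter ?_
    have heq : {ω | ⌈v ω * (n + 1)⌉₊ = j} =
        {ω | ⌈v ω * (n + 1)⌉₊ ≤ j} \ ⋃ i ∈ Finset.range j, {ω | ⌈v ω * (n + 1)⌉₊ ≤ i} := by
      ext ω
      simp only [Set.mem_ofPred_eq, Set.mem_sdiff, Set.mem_iUnion, Finset.mem_range, exists_prop,
        not_exists, not_and, not_le]
      refine ⟨fun h => ⟨h.le, fun i hi => h ▸ hi⟩, fun ⟨h1, h2⟩ => ?_⟩
      by_contra hne
      exact lt_irrefl _ (h2 _ (lt_of_le_of_ne h1 hne))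
    rw [heq]
    refine (hle j le_rfl).diff ?_
    exact Finset.measurableSet_biUnion _ fun i hi => hle i (Finset.mem_range.1 hi).le

lemma measurable_of_forall_measurableSet_le {v : Ω → ℝ≥0}
    (hv : ∀ r, MeasurableSet[𝓕 r] {ω | v ω ≤ r}) : Measurable v :=
  measurable_of_Iic fun r => 𝓕.le r _ (hv r)

lemma measurable_gridApprox (t : ℝ≥0) (n : ℕ) : Measurable (gridApprox t n) := by
  unfold gridApprox
  have : Measurable fun v : ℝ≥0 => ((⌈v * (n + 1)⌉₊ : ℕ) : ℝ≥0) :=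
    (measurable_from_top (f := fun k : ℕ => (k : ℝ≥0))).comp
      (Nat.measurable_ceil.comp (measurable_id.mul_const _))
  exact measurable_const.min (this.div_const _)

namespace IsLocalDensity

lemma measurable_comp (h : IsLocalDensity P Q 𝓕 M) {v : Ω → ℝ≥0} (hv : Measurable v) :
    Measurable fun ω => M (v ω) ω :=
  (measurable_uncurry_of_continuous_of_measurable h.cont h.measurable).comp
    (hv.prodMk measurable_id)

lemma setLIntegral_gridApprox (h : IsLocalDensity P Q 𝓕 M) {s t : ℝ≥0}
    {v : Ω → ℝ≥0} (hv : ∀ r, MeasurableSet[𝓕 r] {ω | v ω ≤ r}) (hvt : ∀ ω, v ω ≤ t)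
    {B : Set Ω} (hB : MeasurableSet[𝓕 s] B) (hsv : ∀ ω ∈ B, s ≤ v ω)
    {g : ℝ → ℝ≥0∞} (hg : Measurable g) (n : ℕ) :
    ∫⁻ ω in B, g (M (gridApprox t n (v ω)) ω) ∂Q =
      ∫⁻ ω in B, ENNReal.ofReal (M (gridApprox t n (v ω)) ω) *
        g (M (gridApprox t n (v ω)) ω) ∂P := by
  set A : ℕ → Set Ω := fun j => B ∩ {ω | ⌈v ω * (n + 1)⌉₊ = j} with hA
  have hAm : ∀ j : ℕ, MeasurableSet[𝓕 (min t (j / (n + 1)))] (A j) :=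
    measurableSet_inter_ceil_eq hv hvt hB hsv n
  have hAm' : ∀ j, MeasurableSet (A j) := fun j => 𝓕.le _ _ (hAm j)
  have hunion : B = ⋃ j, A j := by
    ext ω
    simp [hA]
  have hdisj : Pairwise (Function.onFun Disjoint A) := fun i j hij =>
    Set.disjoint_left.2 fun ω hi hj => hij (hi.2.symm.trans hj.2)
  rw [hunion, lintegral_iUnion hAm' hdisj, lintegral_iUnion hAm' hdisj]
  refine tsum_congr fun j => ?_
  have hval : ∀ ω ∈ A j, gridApprox t n (v ω) = min t (j / (n + 1)) := fun ω hω => by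
    rw [gridApprox, show ⌈v ω * (n + 1)⌉₊ = j from hω.2]
  rw [setLIntegral_congr_fun (hAm' j)
      (g := fun ω => g (M (min t ((j : ℝ≥0) / (n + 1))) ω)) fun ω hω => by
        simp only [hval ω hω],
    h.setLIntegral_eq _ (f := fun ω => g (M (min t ((j : ℝ≥0) / (n + 1))) ω))
      (hg.comp (h.adapted _).measurable) (hAm j)]
  exact setLIntegral_congr_fun (hAm' j) fun ω hω => by simp only [hval ω hω]

/-- Change of measure at a bounded stopping time `v`, for the integrand `1 / max M_v c`. The
truncation makes both sides bounded, which allows the passage to the limit along discrete stopping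
times decreasing to `v`. -/
lemma setLIntegral_inv_max (h : IsLocalDensity P Q 𝓕 M) [IsFiniteMeasure P] [IsFiniteMeasure Q]
    {s t : ℝ≥0} {v : Ω → ℝ≥0} (hv : ∀ r, MeasurableSet[𝓕 r] {ω | v ω ≤ r})
    (hvt : ∀ ω, v ω ≤ t) {B : Set Ω} (hB : MeasurableSet[𝓕 s] B) (hsv : ∀ ω ∈ B, s ≤ v ω)
    {c : ℝ} (hc : 0 < c) :
    ∫⁻ ω in B, ENNReal.ofReal (1 / max (M (v ω) ω) c) ∂Q =
      ∫⁻ ω in B, ENNReal.ofReal (M (v ω) ω / max (M (v ω) ω) c) ∂P := by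
  have hmax : ∀ x : ℝ, 0 < max x c := fun x => lt_max_of_lt_right hc
  have hg : Continuous fun x : ℝ => ENNReal.ofReal (1 / max x c) :=
    ENNReal.continuous_ofReal.comp
      (continuous_const.div (continuous_id.max continuous_const) fun x => (hmax x).ne')
  have hg' : Continuous fun x : ℝ => ENNReal.ofReal (x / max x c) :=
    ENNReal.continuous_ofReal.comp
      (continuous_id.div (continuous_id.max continuous_const) fun x => (hmax x).ne')
  have hgrid := fun n => h.setLIntegral_gridApprox hv hvt hB hsv hg.measurable n
  have hmul : ∀ x : ℝ, 0 ≤ x → ENNReal.ofReal x * ENNReal.ofReal (1 / max x c) =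
      ENNReal.ofReal (x / max x c) := fun x hx => by
    rw [← ENNReal.ofReal_mul hx, mul_one_div]
  simp only [hmul _ (h.nonneg _ _)] at hgrid
  have hvm := measurable_of_forall_measurableSet_le hv
  have hMm : ∀ n, Measurable fun ω => M (gridApprox t n (v ω)) ω := fun n =>
    h.measurable_comp ((measurable_gridApprox t n).comp hvm)
  have hlim : ∀ ω, Tendsto (fun n => M (gridApprox t n (v ω)) ω) atTop (𝓝 (M (v ω) ω)) :=
    fun ω => ((h.cont ω).tendsto _).comp (tendsto_gridApprox (hvt ω))
  have h1 : Tendsto (fun n => ∫⁻ ω in B, ENNReal.ofReal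
      (1 / max (M (gridApprox t n (v ω)) ω) c) ∂Q) atTop
      (𝓝 (∫⁻ ω in B, ENNReal.ofReal (1 / max (M (v ω) ω) c) ∂Q)) := by
    refine tendsto_lintegral_of_dominated_convergence (fun _ => ENNReal.ofReal (1 / c))
      (fun n => hg.measurable.comp (hMm n)) (fun n => ae_of_all _ fun ω => ?_) ?_
      (ae_of_all _ fun ω => (hg.tendsto _).comp (hlim ω))
    · exact ENNReal.ofReal_le_ofReal (one_div_le_one_div_of_le hc (le_max_right _ _))
    · rw [lintegral_const]
      exact ENNReal.mul_ne_top ENNReal.ofReal_ne_top (measure_ne_top _ _)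
  have h2 : Tendsto (fun n => ∫⁻ ω in B, ENNReal.ofReal
      (M (gridApprox t n (v ω)) ω / max (M (gridApprox t n (v ω)) ω) c) ∂P) atTop
      (𝓝 (∫⁻ ω in B, ENNReal.ofReal (M (v ω) ω / max (M (v ω) ω) c) ∂P)) := by
    refine tendsto_lintegral_of_dominated_convergence (fun _ => 1)
      (fun n => hg'.measurable.comp (hMm n)) (fun n => ae_of_all _ fun ω => ?_) ?_
      (ae_of_all _ fun ω => (hg'.tendsto _).comp (hlim ω))
    · rw [← ENNReal.ofReal_one]
      exact ENNReal.ofReal_le_ofReal ((div_le_one (hmax _)).2 (le_max_left _ _))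
    · rw [lintegral_const, one_mul]
      exact measure_ne_top _ _
  simp only [hgrid] at h1
  exact tendsto_nhds_unique h1 h2

end IsLocalDensity

/-! ### Positivity and divergence of the density under `Q` -/

lemma coe_lt_hitZero_iff {ω : Ω} (hM : Continuous fun t => M t ω) {t : ℝ≥0} :
    (t : WithTop ℝ≥0) < hitZero M ω ↔ ∀ u ≤ t, M u ω ≠ 0 := by
  rw [← not_le, hitZero, hittingAfter_le_coe_iff hM isClosed_singleton]
  simp

namespace IsLocalDensity

lemma isStoppingTime_hitZero (h : IsLocalDensity P Q 𝓕 M) : IsStoppingTime 𝓕 (hitZero M) :=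
  isStoppingTime_hittingAfter_of_isClosed h.adapted h.cont isClosed_singleton 0

lemma measurableSet_lt_hitZero (h : IsLocalDensity P Q 𝓕 M) (t : ℝ≥0) :
    MeasurableSet[𝓕 t] {ω | (t : WithTop ℝ≥0) < hitZero M ω} :=
  h.isStoppingTime_hitZero.measurableSet_gt t

/-- The maximal inequality for `1 / M` under `Q`. Let `σ` be the first time after `t` when `M ≤ c`,
truncated at a constant. If the level has been reached then `c / max M_σ c = 1`, and the change of
measure turns the integral of this quantity into that of `c * (M_σ / max M_σ c)` under `P`, which
is at most `c`, and `0` unless `M_σ > 0`. -/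
lemma measure_exists_le (h : IsLocalDensity P Q 𝓕 M) [IsFiniteMeasure P] [IsFiniteMeasure Q]
    {c : ℝ} (hc : 0 < c) (t : ℝ≥0) {E : Set Ω}
    (hE : ∀ᵐ ω ∂P, ∀ u, t ≤ u → 0 < M u ω → ω ∈ E) :
    Q {ω | ∃ u, t ≤ u ∧ M u ω ≤ c} ≤ ENNReal.ofReal c * P E := by
  set τ := hittingAfter M (Set.Iic c) t with hτ
  have hτs : IsStoppingTime 𝓕 τ :=
    isStoppingTime_hittingAfter_of_isClosed h.adapted h.cont isClosed_Iic t
  have hmax : ∀ x : ℝ, 0 < max x c := fun x => lt_max_of_lt_right hc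
  have hfin : ∀ T, t ≤ T → Q {ω | τ ω ≤ (T : WithTop ℝ≥0)} ≤ ENNReal.ofReal c * P E := by
    intro T htT
    set σ := truncTime τ T with hσ
    have key := h.setLIntegral_inv_max (measurableSet_truncTime_le hτs T) (truncTime_le τ T)
      (s := t) MeasurableSet.univ (fun ω _ => le_truncTime htT (le_hittingAfter ω)) hc
    rw [setLIntegral_univ, setLIntegral_univ] at key
    calc Q {ω | τ ω ≤ (T : WithTop ℝ≥0)}
        ≤ ∫⁻ ω, ENNReal.ofReal c * ENNReal.ofReal (1 / max (M (σ ω) ω) c) ∂Q := by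
          rw [← lintegral_indicator_one (𝓕.le T _ (hτs T))]
          refine lintegral_mono fun ω => ?_
          by_cases hω : ω ∈ {ω | τ ω ≤ (T : WithTop ℝ≥0)}
          · have hle : M (σ ω) ω ≤ c := mem_of_hittingAfter_le (h.cont ω) isClosed_Iic hω
            rw [max_eq_right hle, ← ENNReal.ofReal_mul hc.le, mul_one_div, div_self hc.ne',
              Set.indicator_of_mem hω, ENNReal.ofReal_one]
            rfl
          · rw [Set.indicator_of_notMem hω]
            exact zero_le
      _ = ENNReal.ofReal c * ∫⁻ ω, ENNReal.ofReal (M (σ ω) ω / max (M (σ ω) ω) c) ∂P := by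
          rw [lintegral_const_mul' _ _ ENNReal.ofReal_ne_top, key]
      _ ≤ ENNReal.ofReal c * ∫⁻ ω, E.indicator 1 ω ∂P := by
          gcongr ENNReal.ofReal c * ?_
          refine lintegral_mono_ae ?_
          filter_upwards [hE] with ω hω
          rcases (h.nonneg (σ ω) ω).eq_or_lt with h0 | hpos
          · simp [← h0]
          · have := hω _ (le_truncTime htT (le_hittingAfter ω)) hpos
            simp only [Set.indicator_of_mem this, Pi.one_apply, ENNReal.ofReal_le_one]
            exact (div_le_one (hmax _)).2 (le_max_left _ _)
      _ ≤ ENNReal.ofReal c * P E := by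
          gcongr
          exact lintegral_indicator_one_le E
  have hunion : {ω | ∃ u, t ≤ u ∧ M u ω ≤ c} =
      ⋃ n : ℕ, {ω | τ ω ≤ ((t + n : ℝ≥0) : WithTop ℝ≥0)} := by
    ext ω
    simp only [Set.mem_ofPred_eq, Set.mem_iUnion]
    constructor
    · rintro ⟨u, htu, huc⟩
      obtain ⟨n, hn⟩ := exists_nat_ge u
      exact ⟨n, (hittingAfter_le_of_mem htu huc).trans
        (WithTop.coe_le_coe.2 (hn.trans le_add_self))⟩
    · rintro ⟨n, hn⟩
      obtain ⟨v, hv, hvc⟩ := (hittingAfter_le_coe_iff (h.cont ω) isClosed_Iic).1 hn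
      exact ⟨v, hv.1, hvc⟩
  have hmono : Monotone fun n : ℕ => {ω | τ ω ≤ ((t + n : ℝ≥0) : WithTop ℝ≥0)} :=
    fun m n hmn ω hω => le_trans (Set.mem_ofPred.1 hω)
      (WithTop.coe_le_coe.2 (by gcongr))
  rw [hunion, hmono.measure_iUnion]
  exact iSup_le fun n => hfin _ le_self_add

lemma ae_forall_pos (h : IsLocalDensity P Q 𝓕 M) [IsFiniteMeasure P] [IsFiniteMeasure Q] :
    ∀ᵐ ω ∂Q, ∀ t, 0 < M t ω := by
  have hle : ∀ n : ℕ, Q {ω | ¬ ∀ t, 0 < M t ω} ≤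
      ENNReal.ofReal (1 / ((n : ℝ) + 1)) * P Set.univ := fun n => by
    refine (measure_mono fun ω hω => ?_).trans
      (h.measure_exists_le (c := 1 / ((n : ℝ) + 1)) (by positivity) 0
        (ae_of_all _ fun ω _ _ _ => Set.mem_univ ω))
    simp only [Set.mem_ofPred_eq, not_forall, not_lt] at hω ⊢
    obtain ⟨t, ht⟩ := hω
    exact ⟨t, zero_le, ht.trans (by positivity)⟩
  have hlim : Tendsto (fun n : ℕ => ENNReal.ofReal (1 / ((n : ℝ) + 1)) * P Set.univ) atTop
      (𝓝 0) := by
    have := ENNReal.tendsto_ofReal (tendsto_one_div_add_atTop_nhds_zero_nat (𝕜 := ℝ))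
    simpa using ENNReal.Tendsto.mul_const this (Or.inr (measure_ne_top P Set.univ))
  exact le_antisymm (ge_of_tendsto' hlim hle) bot_le

lemma ae_hitZero_eq_top (h : IsLocalDensity P Q 𝓕 M) [IsFiniteMeasure P] [IsFiniteMeasure Q] :
    ∀ᵐ ω ∂Q, hitZero M ω = ⊤ := by
  filter_upwards [h.ae_forall_pos] with ω hω
  exact hittingAfter_eq_top_iff.2 fun j _ => (hω j).ne'

/-- Under `P`, the density stays at `0` from the time it vanishes. This follows from its
positivity under `Q`, because the integral of `M_t` over `{T₀ ≤ t}` under `P` is `Q (T₀ ≤ t)`. -/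
lemma ae_eq_zero_of_hitZero_le (h : IsLocalDensity P Q 𝓕 M) [IsFiniteMeasure P]
    [IsFiniteMeasure Q] :
    ∀ᵐ ω ∂P, ∀ t : ℝ≥0, hitZero M ω ≤ t → M t ω = 0 := by
  have hfix : ∀ t : ℝ≥0, ∀ᵐ ω ∂P, hitZero M ω ≤ t → M t ω = 0 := fun t => by
    have hm := h.isStoppingTime_hitZero t
    have h0 : Q {ω | hitZero M ω ≤ t} = 0 := by
      refine measure_mono_null (fun ω hω => ?_) h.ae_hitZero_eq_top
      exact (lt_of_le_of_lt hω (WithTop.coe_lt_top t)).ne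
    rw [h.apply_eq t _ hm, lintegral_eq_zero_iff (h.measurable t).ennreal_ofReal,
      EventuallyEq, ae_restrict_iff' (𝓕.le t _ hm)] at h0
    filter_upwards [h0] with ω hω hle
    exact le_antisymm (ENNReal.ofReal_eq_zero.1 (hω hle)) (h.nonneg t ω)
  have hall := ae_all_iff.2 fun n : ℕ => hfix (TopologicalSpace.denseSeq ℝ≥0 n)
  filter_upwards [hall] with ω hω t ht
  by_contra hne
  obtain ⟨r, hr⟩ := WithTop.ne_top_iff_exists.1 (ht.trans_lt (WithTop.coe_lt_top t)).ne
  have hr0 : M r ω = 0 := mem_of_hittingAfter_eq_coe (h.cont ω) isClosed_singleton hr.symm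
  have hrt : r < t := by
    rw [← hr, WithTop.coe_le_coe] at ht
    exact lt_of_le_of_ne ht fun heq => hne (heq ▸ hr0)
  obtain ⟨n, hn⟩ := (TopologicalSpace.denseRange_denseSeq ℝ≥0).exists_mem_open
    ((isOpen_ne_fun (h.cont ω) continuous_const).inter isOpen_Ioi) ⟨t, hne, hrt⟩
  refine hn.1 (hω n ?_)
  rw [← hr, WithTop.coe_le_coe]
  exact hn.2.le

lemma ae_lt_hitZero_iff (h : IsLocalDensity P Q 𝓕 M) [IsFiniteMeasure P] [IsFiniteMeasure Q] :
    ∀ᵐ ω ∂P, ∀ t : ℝ≥0, (t : WithTop ℝ≥0) < hitZero M ω ↔ 0 < M t ω := by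
  filter_upwards [h.ae_eq_zero_of_hitZero_le] with ω hω t
  refine ⟨fun hlt => (h.nonneg t ω).lt_of_ne'
    ((coe_lt_hitZero_iff (h.cont ω)).1 hlt t le_rfl), fun hpos => ?_⟩
  by_contra hle
  exact hpos.ne' (hω t (not_lt.1 hle))

lemma tendsto_measure_lt_hitZero (h : IsLocalDensity P Q 𝓕 M) [IsFiniteMeasure P]
    (hT : ∀ᵐ ω ∂P, hitZero M ω < ⊤) :
    Tendsto (fun n : ℕ => P {ω | ((n : ℝ≥0) : WithTop ℝ≥0) < hitZero M ω}) atTop (𝓝 0) := by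
  have hanti : Antitone fun n : ℕ => {ω | ((n : ℝ≥0) : WithTop ℝ≥0) < hitZero M ω} :=
    fun m n hmn ω hω => lt_of_le_of_lt (WithTop.coe_le_coe.2 (by exact_mod_cast hmn))
      (Set.mem_ofPred.1 hω)
  have := tendsto_measure_iInter_atTop (μ := P)
    (fun n : ℕ => (𝓕.le n _ (h.measurableSet_lt_hitZero n)).nullMeasurableSet) hanti
    ⟨0, measure_ne_top _ _⟩
  have h0 : P (⋂ n : ℕ, {ω | ((n : ℝ≥0) : WithTop ℝ≥0) < hitZero M ω}) = 0 := by
    refine measure_mono_null (t := {ω | ¬ hitZero M ω < ⊤}) (fun ω hω hlt => ?_) hT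
    obtain ⟨r, hr⟩ := WithTop.ne_top_iff_exists.1 (ne_of_lt hlt)
    obtain ⟨n, hn⟩ := exists_nat_ge r
    have := Set.mem_iInter.1 hω n
    simp only [Set.mem_ofPred_eq, ← hr, WithTop.coe_lt_coe] at this
    exact this.not_ge hn
  rwa [h0] at this

/-- Under `Q` the density tends to infinity: after time `n` it goes below a given level `c` with
probability at most `c * P (n < T₀)`. -/
lemma ae_tendsto_atTop (h : IsLocalDensity P Q 𝓕 M) [IsFiniteMeasure P] [IsFiniteMeasure Q]
    (hT : ∀ᵐ ω ∂P, hitZero M ω < ⊤) :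
    ∀ᵐ ω ∂Q, Tendsto (fun t => M t ω) atTop atTop := by
  have hlevel : ∀ k : ℕ, ∀ᵐ ω ∂Q, ∃ n : ℕ, ∀ u : ℝ≥0, n ≤ u → (k : ℝ) + 1 < M u ω := by
    intro k
    have hle : ∀ n : ℕ, Q {ω | ¬ ∃ n : ℕ, ∀ u : ℝ≥0, n ≤ u → (k : ℝ) + 1 < M u ω} ≤
        ENNReal.ofReal ((k : ℝ) + 1) * P {ω | ((n : ℝ≥0) : WithTop ℝ≥0) < hitZero M ω} := by
      intro n
      refine (measure_mono fun ω hω => ?_).trans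
        (h.measure_exists_le (c := (k : ℝ) + 1) (by positivity) n ?_)
      · simp only [Set.mem_ofPred_eq, not_exists, not_forall, not_lt, exists_prop] at hω ⊢
        exact hω n
      · filter_upwards [h.ae_lt_hitZero_iff] with ω hω u hu hpos
        exact lt_of_le_of_lt (WithTop.coe_le_coe.2 hu) ((hω u).2 hpos)
    have hlim := ENNReal.Tendsto.const_mul (h.tendsto_measure_lt_hitZero hT)
      (Or.inr (ENNReal.ofReal_ne_top (r := (k : ℝ) + 1)))
    rw [mul_zero] at hlim
    exact le_antisymm (ge_of_tendsto' hlim hle) bot_le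
  filter_upwards [ae_all_iff.2 hlevel] with ω hω
  refine tendsto_atTop.2 fun b => ?_
  obtain ⟨k, hk⟩ := exists_nat_ge b
  obtain ⟨n, hn⟩ := hω k
  filter_upwards [eventually_ge_atTop (n : ℝ≥0)] with u hu
  linarith [hn u hu]

end IsLocalDensity

/-! ### The reciprocal process as a strict local martingale -/

lemma recipProcess_eq_of_lt {t : ℝ≥0} {ω : Ω} (ht : (t : WithTop ℝ≥0) < hitZero M ω) :
    recipProcess M t ω = 1 / M t ω :=
  Set.indicator_of_mem (s := {ω | (t : WithTop ℝ≥0) < hitZero M ω}) ht _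

lemma recipProcess_eq_of_hitZero_eq_top {ω : Ω} (hω : hitZero M ω = ⊤) (t : ℝ≥0) :
    recipProcess M t ω = 1 / M t ω :=
  recipProcess_eq_of_lt (hω ▸ WithTop.coe_lt_top t)

lemma recipProcess_eq_zero {t : ℝ≥0} {ω : Ω} (ht : ¬ (t : WithTop ℝ≥0) < hitZero M ω) :
    recipProcess M t ω = 0 :=
  Set.indicator_of_notMem (s := {ω | (t : WithTop ℝ≥0) < hitZero M ω}) ht _

/-- The first time at which `M` is at most `1 / (n + 2)`: before it, `1 / M` is at most `n + 2`. -/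
noncomputable def lowTime (M : ℝ≥0 → Ω → ℝ) (n : ℕ) : Ω → WithTop ℝ≥0 :=
  hittingAfter M (Set.Iic (1 / ((n : ℝ) + 2))) 0

lemma le_of_le_hittingAfter_Iic {ω : Ω} (hM : Continuous fun t => M t ω) {c : ℝ} {u : ℝ≥0}
    (h0 : ⊥ < hittingAfter M (Set.Iic c) 0 ω) (hu : (u : WithTop ℝ≥0) ≤
      hittingAfter M (Set.Iic c) 0 ω) : c ≤ M u ω := by
  refine mem_of_le_hittingAfter (C := Set.Iic c) (K := Set.Ici c) hM isClosed_Ici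
    (fun v hv => Set.mem_Ici.2 (Set.notMem_Iic.1 hv).le) ?_ zero_le hu
  by_contra hge
  have hlt : M 0 ω < c := lt_of_not_ge hge
  exact h0.not_ge (hittingAfter_le_of_mem (i := 0) le_rfl hlt.le)

namespace IsLocalDensity

lemma measurable_recip (h : IsLocalDensity P Q 𝓕 M) (t : ℝ≥0) :
    Measurable[𝓕 t] (recipProcess M t) :=
  ((h.adapted t).measurable.const_div 1).indicator (h.measurableSet_lt_hitZero t)

lemma isStoppingTime_lowTime (h : IsLocalDensity P Q 𝓕 M) (n : ℕ) :
    IsStoppingTime 𝓕 (lowTime M n) :=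
  isStoppingTime_hittingAfter_of_isClosed h.adapted h.cont isClosed_Iic 0

lemma isLocalizingSequence_lowTime (h : IsLocalDensity P Q 𝓕 M) [IsFiniteMeasure P]
    [IsFiniteMeasure Q] : IsLocalizingSequence 𝓕 (lowTime M) Q where
  isStoppingTime := h.isStoppingTime_lowTime
  tendsto_top := by
    filter_upwards [h.ae_forall_pos] with ω hω
    rw [WithTop.tendsto_nhds_top_iff]
    intro i
    obtain ⟨v, -, hv⟩ := (isCompact_Icc (a := (0 : ℝ≥0)) (b := i)).exists_isMinOn
      (Set.nonempty_Icc.2 zero_le) (h.cont ω).continuousOn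
    obtain ⟨k, hk⟩ := exists_nat_gt (1 / M v ω)
    filter_upwards [eventually_ge_atTop k] with n hn
    by_contra! hle
    obtain ⟨w, hw, hwn⟩ := (hittingAfter_le_coe_iff (h.cont ω) isClosed_Iic).1 hle
    have h1 : M v ω ≤ 1 / ((n : ℝ) + 2) := (hv hw).trans hwn
    rw [le_div_iff₀ (by positivity)] at h1
    rw [div_lt_iff₀ (hω v)] at hk
    have hkn : (k : ℝ) ≤ n := by exact_mod_cast hn
    nlinarith [hω v]
  mono := ae_of_all _ fun ω m n hmn => hittingAfter_anti M 0
    (Set.Iic_subset_Iic.2 (one_div_le_one_div_of_le (by positivity) (by gcongr))) ω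

lemma stopped_recip_eq (h : IsLocalDensity P Q 𝓕 M) (n : ℕ) :
    stoppedProcess (fun i => {ω | ⊥ < lowTime M n ω}.indicator (recipProcess M i))
        (lowTime M n) =
      fun t => {ω | ⊥ < lowTime M n ω}.indicator fun ω =>
        1 / max (M (truncTime (lowTime M n) t ω) ω) (1 / ((n : ℝ) + 2)) := by
  ext t ω
  rw [stoppedProcess_indicator_comm]
  by_cases hω : ω ∈ {ω | ⊥ < lowTime M n ω}
  · rw [Set.indicator_of_mem hω, Set.indicator_of_mem hω]
    have hle := fun u hu => le_of_le_hittingAfter_Iic (h.cont ω) hω (u := u) hu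
    have hσ := coe_truncTime_le (lowTime M n) t ω
    rw [max_eq_left (hle _ hσ)]
    refine recipProcess_eq_of_lt ((coe_lt_hitZero_iff (h.cont ω)).2 fun u hu => ?_)
    have hpos : (0 : ℝ) < 1 / ((n : ℝ) + 2) := by positivity
    exact (hpos.trans_le (hle u ((WithTop.coe_le_coe.2 hu).trans hσ))).ne'
  · rw [Set.indicator_of_notMem hω, Set.indicator_of_notMem hω]

/-- The change of measure turns `1 / M_σ` into `1` for every stopping time `σ` up to which `M`
remains above a positive level, whence the martingale property of the stopped reciprocal. -/
lemma setLIntegral_lowTime (h : IsLocalDensity P Q 𝓕 M) [IsFiniteMeasure P] [IsFiniteMeasure Q]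
    (n : ℕ) {s t : ℝ≥0} (hst : s ≤ t) {B : Set Ω} (hB : MeasurableSet[𝓕 s] B)
    (hBs : ∀ ω ∈ B, (s : WithTop ℝ≥0) < lowTime M n ω) :
    ∫⁻ ω in B, ENNReal.ofReal
      (1 / max (M (truncTime (lowTime M n) t ω) ω) (1 / ((n : ℝ) + 2))) ∂Q = P B := by
  have hc : (0 : ℝ) < 1 / ((n : ℝ) + 2) := by positivity
  rw [h.setLIntegral_inv_max (measurableSet_truncTime_le (h.isStoppingTime_lowTime n) t)
    (truncTime_le _ t) hB (fun ω hω => le_truncTime hst (hBs ω hω).le) hc,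
    setLIntegral_congr_fun (g := fun _ => 1) (𝓕.le s _ hB), setLIntegral_one]
  intro ω hω
  have hle := le_of_le_hittingAfter_Iic (h.cont ω) (bot_le.trans_lt (hBs ω hω))
    (coe_truncTime_le (lowTime M n) t ω)
  simp only
  rw [max_eq_left hle, div_self (hc.trans_le hle).ne', ENNReal.ofReal_one]

lemma martingale_stopped_recip (h : IsLocalDensity P Q 𝓕 M) [IsFiniteMeasure P]
    [IsFiniteMeasure Q] (n : ℕ) :
    Martingale (stoppedProcess (fun i => {ω | ⊥ < lowTime M n ω}.indicator (recipProcess M i))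
      (lowTime M n)) 𝓕 Q := by
  rw [h.stopped_recip_eq n]
  set τ := lowTime M n with hτ
  set c : ℝ := 1 / ((n : ℝ) + 2) with hcdef
  have hc : 0 < c := by positivity
  have hτs : IsStoppingTime 𝓕 τ := h.isStoppingTime_lowTime n
  set Z : ℝ≥0 → Ω → ℝ := fun t ω => 1 / max (M (truncTime τ t ω) ω) c with hZ
  set A : Set Ω := {ω | ⊥ < τ ω} with hA
  have hAm : ∀ t, MeasurableSet[𝓕 t] A := fun t => 𝓕.mono zero_le _ (hτs.measurableSet_gt 0)
  have hZ0 : ∀ t ω, 0 ≤ Z t ω := fun t ω =>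
    one_div_nonneg.2 (hc.le.trans (le_max_right _ _))
  have hZc : ∀ t ω, Z t ω ≤ 1 / c := fun t ω => one_div_le_one_div_of_le hc (le_max_right _ _)
  have hadp : StronglyAdapted 𝓕 fun t => A.indicator (Z t) := fun t => by
    have hs := (StronglyAdapted.stoppedProcess h.adapted h.cont hτs t).measurable
    have : Measurable[𝓕 t] (Z t) := (hs.max measurable_const).const_div 1
    exact (this.indicator (hAm t)).stronglyMeasurable
  have hint : ∀ t, Integrable (A.indicator (Z t)) Q := fun t => by
    refine Integrable.of_bound ((hadp t).mono (𝓕.le t)).aestronglyMeasurable (1 / c)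
      (ae_of_all _ fun ω => ?_)
    rw [Real.norm_eq_abs]
    by_cases hω : ω ∈ A
    · rw [Set.indicator_of_mem hω, abs_of_nonneg (hZ0 t ω)]
      exact hZc t ω
    · rw [Set.indicator_of_notMem hω, abs_zero]
      positivity
  refine ⟨hadp, fun s t hst => ?_⟩
  refine (ae_eq_condExp_of_forall_setIntegral_eq (𝓕.le s) (hint t)
    (fun B _ _ => (hint s).integrableOn) (fun B hB _ => ?_) (hadp s).aestronglyMeasurable).symm
  -- after `τ` both sides agree; before `τ` the change of measure applies
  set D : Set Ω := {ω | (s : WithTop ℝ≥0) < τ ω} with hD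
  have hDm : MeasurableSet[𝓕 s] D := hτs.measurableSet_gt s
  have hBm := 𝓕.le s _ hB
  have hsplit := fun r => integral_inter_add_sdiff (𝓕.le s _ hDm) (hint r).integrableOn (s := B)
  rw [← hsplit s, ← hsplit t]
  congr 1
  · have hval : ∀ r, s ≤ r → ∫ ω in B ∩ D, A.indicator (Z r) ω ∂Q = (P (B ∩ D)).toReal := by
      intro r hsr
      rw [integral_eq_lintegral_of_nonneg_ae
        (ae_of_all _ fun ω => Set.indicator_nonneg (fun ω _ => hZ0 r ω) ω)
        (hint r).aestronglyMeasurable.restrict,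
        ← h.setLIntegral_lowTime n hsr (hB.inter hDm) fun ω hω => hω.2]
      congr 1
      refine setLIntegral_congr_fun (hBm.inter (𝓕.le s _ hDm)) fun ω hω => ?_
      have hlt : (s : WithTop ℝ≥0) < τ ω := hω.2
      have hωA : ω ∈ A := Set.mem_ofPred.2 (bot_le.trans_lt hlt)
      exact congrArg ENNReal.ofReal (Set.indicator_of_mem hωA _)
    rw [hval s le_rfl, hval t hst]
  · refine setIntegral_congr_fun (hBm.diff (𝓕.le s _ hDm)) fun ω hω => ?_
    have hle : τ ω ≤ s := not_lt.1 hω.2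
    have : truncTime τ s ω = truncTime τ t ω := by
      rw [← WithTop.coe_inj, coe_truncTime, coe_truncTime, min_eq_right hle,
        min_eq_right (hle.trans (WithTop.coe_le_coe.2 hst))]
    simp only [Set.indicator, hZ, this]

lemma isLocalMartingale_recip (h : IsLocalDensity P Q 𝓕 M) [IsFiniteMeasure P]
    [IsFiniteMeasure Q] : IsLocalMartingale (recipProcess M) 𝓕 Q :=
  ⟨lowTime M, h.isLocalizingSequence_lowTime, h.martingale_stopped_recip⟩

lemma ae_init (h : IsLocalDensity P Q 𝓕 M) (h0 : ∀ᵐ ω ∂P, M 0 ω = 1) :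
    ∀ᵐ ω ∂Q, M 0 ω = 1 := by
  have hm : MeasurableSet[𝓕 0] {ω | M 0 ω = 1} :=
    (h.adapted 0).measurable (measurableSet_singleton 1)
  change Q {ω | M 0 ω = 1}ᶜ = 0
  rw [h.apply_eq 0 _ hm.compl]
  exact setLIntegral_measure_zero _ _ h0

lemma classLZeroPlus_recip (h : IsLocalDensity P Q 𝓕 M) [IsFiniteMeasure P]
    [IsFiniteMeasure Q] (h0 : ∀ᵐ ω ∂P, M 0 ω = 1) (hT : ∀ᵐ ω ∂P, hitZero M ω < ⊤) :
    ClassLZeroPlus (recipProcess M) 𝓕 Q where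
  isLocalMartingale := h.isLocalMartingale_recip
  nonneg := by
    filter_upwards [h.ae_hitZero_eq_top] with ω hω t
    rw [recipProcess_eq_of_hitZero_eq_top hω]
    exact one_div_nonneg.2 (h.nonneg t ω)
  continuous := by
    filter_upwards [h.ae_hitZero_eq_top, h.ae_forall_pos] with ω hω hpos
    simp_rw [recipProcess_eq_of_hitZero_eq_top hω]
    exact continuous_const.div (h.cont ω) fun t => (hpos t).ne'
  init := by
    refine ⟨1, one_pos, ?_⟩
    filter_upwards [h.ae_hitZero_eq_top, h.ae_init h0] with ω hω h1
    rw [recipProcess_eq_of_hitZero_eq_top hω, h1, div_one]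
  tendsto_zero := by
    filter_upwards [h.ae_hitZero_eq_top, h.ae_tendsto_atTop hT] with ω hω hlim
    simp_rw [recipProcess_eq_of_hitZero_eq_top hω, one_div]
    exact hlim.inv_tendsto_atTop

/-- The expectation of the reciprocal under `Q` is the probability under `P` that the density has
not vanished yet. -/
lemma lintegral_recip (h : IsLocalDensity P Q 𝓕 M) (t : ℝ≥0) :
    ∫⁻ ω, ENNReal.ofReal (recipProcess M t ω) ∂Q =
      P {ω | (t : WithTop ℝ≥0) < hitZero M ω} := by
  rw [h.lintegral_eq t (h.measurable_recip t).ennreal_ofReal,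
    ← lintegral_indicator_one (𝓕.le t _ (h.measurableSet_lt_hitZero t))]
  refine lintegral_congr fun ω => ?_
  by_cases hω : ω ∈ {ω | (t : WithTop ℝ≥0) < hitZero M ω}
  · rw [Set.indicator_of_mem hω, recipProcess_eq_of_lt hω, ← ENNReal.ofReal_mul (h.nonneg t ω),
      mul_one_div, div_self ((coe_lt_hitZero_iff (h.cont ω)).1 hω t le_rfl)]
    simp
  · rw [Set.indicator_of_notMem hω, recipProcess_eq_zero hω]
    simp

lemma not_martingale_recip (h : IsLocalDensity P Q 𝓕 M) [IsFiniteMeasure P]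
    [IsProbabilityMeasure Q] (h0 : ∀ᵐ ω ∂P, M 0 ω = 1) (hT : ∀ᵐ ω ∂P, hitZero M ω < ⊤) :
    ¬ Martingale (recipProcess M) 𝓕 Q := by
  intro hmart
  have hnn : ∀ t ω, 0 ≤ recipProcess M t ω := fun t ω =>
    Set.indicator_nonneg (fun ω _ => one_div_nonneg.2 (h.nonneg t ω)) ω
  have hone : ∀ t, ∫ ω, recipProcess M t ω ∂Q = 1 := fun t => by
    have heq := hmart.setIntegral_eq (zero_le (a := t)) MeasurableSet.univ
    rw [setIntegral_univ, setIntegral_univ] at heq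
    rw [← heq, integral_congr_ae (g := fun _ => 1)]
    · simp
    · filter_upwards [h.ae_hitZero_eq_top, h.ae_init h0] with ω hω h1
      rw [recipProcess_eq_of_hitZero_eq_top hω, h1, div_one]
  have hP : ∀ n : ℕ, 1 = P {ω | ((n : ℝ≥0) : WithTop ℝ≥0) < hitZero M ω} := fun n => by
    rw [← h.lintegral_recip, ← ofReal_integral_eq_lintegral_ofReal (hmart.integrable n)
      (ae_of_all _ (hnn n)), hone, ENNReal.ofReal_one]
  have hlim := h.tendsto_measure_lt_hitZero hT
  simp only [← hP] at hlim
  exact one_ne_zero (tendsto_nhds_unique tendsto_const_nhds hlim)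

end IsLocalDensity

/-! ### The law of the last passage time at `1` -/

namespace IsLocalDensity

/-- If `M` vanishes in finite time, the stopped values `min M 1` at the first time after `s` when
`M ≥ 1` converge to the indicator that this happens. -/
lemma ae_tendsto_stopped (h : IsLocalDensity P Q 𝓕 M) [IsFiniteMeasure P] [IsFiniteMeasure Q]
    (hT : ∀ᵐ ω ∂P, hitZero M ω < ⊤) (s : ℝ≥0) :
    ∀ᵐ ω ∂P, Tendsto (fun n : ℕ =>
      M (truncTime (hittingAfter M (Set.Ici 1) s) (s + n) ω) ω /
        max (M (truncTime (hittingAfter M (Set.Ici 1) s) (s + n) ω) ω) 1) atTop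
      (𝓝 ({ω | hittingAfter M (Set.Ici 1) s ω < ⊤}.indicator 1 ω)) := by
  filter_upwards [hT, h.ae_eq_zero_of_hitZero_le] with ω hTω hzero
  set ρ := hittingAfter M (Set.Ici 1) s with hρ
  by_cases hω : ω ∈ {ω | ρ ω < ⊤}
  · rw [Set.indicator_of_mem hω, Pi.one_apply]
    obtain ⟨r, hr⟩ := WithTop.ne_top_iff_exists.1 (Set.mem_ofPred.1 hω).ne
    obtain ⟨k, hk⟩ := exists_nat_ge r
    refine tendsto_const_nhds.congr' ?_
    filter_upwards [eventually_ge_atTop k] with n hn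
    have hle : ρ ω ≤ ((s + n : ℝ≥0) : WithTop ℝ≥0) := by
      rw [← hr, WithTop.coe_le_coe]
      exact hk.trans ((Nat.cast_le.2 hn).trans le_add_self)
    have hmem : 1 ≤ M (truncTime ρ (s + n) ω) ω :=
      mem_of_hittingAfter_le (h.cont ω) isClosed_Ici hle
    rw [max_eq_left hmem, div_self (one_pos.trans_le hmem).ne']
  · rw [Set.indicator_of_notMem hω]
    have htop : ρ ω = ⊤ := not_lt_top_iff.1 hω
    obtain ⟨r, hr⟩ := WithTop.ne_top_iff_exists.1 (ne_of_lt hTω)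
    obtain ⟨k, hk⟩ := exists_nat_ge r
    refine tendsto_const_nhds.congr' ?_
    filter_upwards [eventually_ge_atTop k] with n hn
    have ht : truncTime ρ (s + n) ω = s + n := by
      rw [← WithTop.coe_inj, coe_truncTime, htop, min_eq_left le_top]
    rw [ht, hzero, zero_div]
    rw [← hr, WithTop.coe_le_coe]
    exact hk.trans ((Nat.cast_le.2 hn).trans le_add_self)

/-- Doob's maximal identity: conditionally on `𝓕 s`, the density reaches level `1` after time `s`
with probability `min M_s 1`, written here as `M_s / max M_s 1`. -/
lemma measure_inter_exists_ge (h : IsLocalDensity P Q 𝓕 M) [IsFiniteMeasure P]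
    [IsFiniteMeasure Q] (hT : ∀ᵐ ω ∂P, hitZero M ω < ⊤) (s : ℝ≥0) {B : Set Ω}
    (hB : MeasurableSet[𝓕 s] B) :
    P (B ∩ {ω | hittingAfter M (Set.Ici 1) s ω < ⊤}) =
      ∫⁻ ω in B, ENNReal.ofReal (M s ω / max (M s ω) 1) ∂P := by
  set ρ := hittingAfter M (Set.Ici 1) s with hρ
  have hρs : IsStoppingTime 𝓕 ρ :=
    isStoppingTime_hittingAfter_of_isClosed h.adapted h.cont isClosed_Ici s
  have hB' := 𝓕.le s _ hB
  have hsρ : ∀ T, s ≤ T → ∀ ω, s ≤ truncTime ρ T ω := fun T hT ω =>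
    le_truncTime hT (le_hittingAfter ω)
  have hconst : ∀ n : ℕ, ∫⁻ ω in B, ENNReal.ofReal (M (truncTime ρ (s + n) ω) ω /
      max (M (truncTime ρ (s + n) ω) ω) 1) ∂P =
        ∫⁻ ω in B, ENNReal.ofReal (M s ω / max (M s ω) 1) ∂P := by
    intro n
    have hsn : s ≤ s + (n : ℝ≥0) := le_self_add
    have key := h.setLIntegral_inv_max (measurableSet_truncTime_le hρs (s + n))
      (truncTime_le ρ (s + n)) hB (fun ω _ => hsρ _ hsn ω) one_pos
    have key0 := h.setLIntegral_inv_max (v := fun _ => s) (s := s) (t := s)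
      (fun r => @MeasurableSet.const _ (𝓕 r) (s ≤ r)) (fun _ => le_rfl) hB
      (fun _ _ => le_rfl) one_pos
    rw [← key, ← key0]
    refine lintegral_congr fun ω => ?_
    congr 2
    rcases le_total (M s ω) 1 with hle | hge
    · have : M (truncTime ρ (s + n) ω) ω ∈ Set.Iic (1 : ℝ) :=
        mem_of_le_hittingAfter (C := Set.Ici 1) (h.cont ω) isClosed_Iic
          (fun x hx => Set.mem_Iic.2 (Set.notMem_Ici.1 hx).le) hle (hsρ _ hsn ω)
          (coe_truncTime_le ρ _ ω)
      rw [max_eq_right hle, max_eq_right this]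
    · have : truncTime ρ (s + n) ω = s := le_antisymm
        (WithTop.coe_le_coe.1 ((coe_truncTime_le ρ _ ω).trans
          (hittingAfter_le_of_mem le_rfl hge))) (hsρ _ hsn ω)
      rw [this]
  have hset : MeasurableSet {ω | ρ ω < ⊤} := hρs.measurable' measurableSet_Iio
  have hg : Continuous fun x : ℝ => x / max x 1 :=
    continuous_id.div (continuous_id.max continuous_const)
      fun x => (lt_max_of_lt_right one_pos).ne'
  have hlim : Tendsto (fun n : ℕ => ∫⁻ ω in B, ENNReal.ofReal (M (truncTime ρ (s + n) ω) ω /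
      max (M (truncTime ρ (s + n) ω) ω) 1) ∂P) atTop
      (𝓝 (∫⁻ ω in B, {ω | ρ ω < ⊤}.indicator 1 ω ∂P)) := by
    refine tendsto_lintegral_of_dominated_convergence (fun _ => 1) (fun n => ?_)
      (fun n => ae_of_all _ fun ω => ?_) ?_ (ae_restrict_of_ae ?_)
    · exact (hg.measurable.comp (h.measurable_comp (measurable_of_forall_measurableSet_le
        (measurableSet_truncTime_le hρs (s + n))))).ennreal_ofReal
    · rw [← ENNReal.ofReal_one]
      exact ENNReal.ofReal_le_ofReal
        ((div_le_one (lt_max_of_lt_right one_pos)).2 (le_max_left _ _))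
    · rw [lintegral_const, one_mul]
      exact measure_ne_top _ _
    · filter_upwards [h.ae_tendsto_stopped hT s] with ω hω
      have := ENNReal.tendsto_ofReal hω
      by_cases hmem : ω ∈ {ω | ρ ω < ⊤}
      · rw [Set.indicator_of_mem hmem] at this ⊢
        simpa using this
      · rw [Set.indicator_of_notMem hmem] at this ⊢
        simpa using this
  rw [lintegral_indicator_one hset, Measure.restrict_apply hset, Set.inter_comm] at hlim
  simp only [hconst] at hlim
  exact tendsto_nhds_unique hlim tendsto_const_nhds

/-- Doob's maximal identity for times strictly after `t`. The distinction from `u ≥ t` matters on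
`{M_t = 1}`, where it says that the density returns to `[1, ∞)` almost surely. -/
lemma measure_inter_exists_gt (h : IsLocalDensity P Q 𝓕 M) [IsFiniteMeasure P]
    [IsFiniteMeasure Q] (hT : ∀ᵐ ω ∂P, hitZero M ω < ⊤) (t : ℝ≥0) :
    MeasurableSet {ω | ∃ u, t < u ∧ 1 ≤ M u ω} ∧ ∀ B, MeasurableSet[𝓕 t] B →
      P (B ∩ {ω | ∃ u, t < u ∧ 1 ≤ M u ω}) =
        ∫⁻ ω in B, ENNReal.ofReal (M t ω / max (M t ω) 1) ∂P := by
  set r : ℕ → ℝ≥0 := fun n => t + 1 / ((n : ℝ≥0) + 1) with hr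
  have hrt : ∀ n, t < r n := fun n => lt_add_of_pos_right t (by positivity)
  have hrlim : Tendsto r atTop (𝓝 t) := by
    simpa [hr] using tendsto_const_nhds (x := t).add
      (tendsto_one_div_add_atTop_nhds_zero_nat (𝕜 := ℝ≥0))
  have hunion : {ω | ∃ u, t < u ∧ 1 ≤ M u ω} =
      ⋃ n, {ω | hittingAfter M (Set.Ici 1) (r n) ω < ⊤} := by
    ext ω
    simp only [Set.mem_iUnion, Set.mem_ofPred_eq, hittingAfter_lt_top_iff, Set.mem_Ici]
    constructor
    · rintro ⟨u, hu, h1⟩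
      obtain ⟨n, hn⟩ := (hrlim.eventually (gt_mem_nhds hu)).exists
      exact ⟨n, u, hn.le, h1⟩
    · rintro ⟨n, u, hu, h1⟩
      exact ⟨u, (hrt n).trans_le hu, h1⟩
  have hmeas : ∀ n, MeasurableSet {ω | hittingAfter M (Set.Ici 1) (r n) ω < ⊤} := fun n =>
    (isStoppingTime_hittingAfter_of_isClosed h.adapted h.cont isClosed_Ici (r n)).measurable'
      measurableSet_Iio
  refine ⟨hunion ▸ MeasurableSet.iUnion hmeas, fun B hB => ?_⟩
  have hranti : Antitone r := fun m n hmn => by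
    simp only [hr]
    gcongr
  have hmono : Monotone fun n => B ∩ {ω | hittingAfter M (Set.Ici 1) (r n) ω < ⊤} :=
    fun m n hmn => Set.inter_subset_inter_right _ fun ω hω =>
      (hittingAfter_mono M (Set.Ici 1) (hranti hmn) ω).trans_lt hω
  have hlim1 := tendsto_measure_iUnion_atTop (μ := P) hmono
  rw [← Set.inter_iUnion, ← hunion] at hlim1
  have hg : Continuous fun x : ℝ => ENNReal.ofReal (x / max x 1) :=
    ENNReal.continuous_ofReal.comp (continuous_id.div (continuous_id.max continuous_const)
      fun x => (lt_max_of_lt_right one_pos).ne')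
  have hlim2 : Tendsto (fun n => ∫⁻ ω in B, ENNReal.ofReal (M (r n) ω / max (M (r n) ω) 1) ∂P)
      atTop (𝓝 (∫⁻ ω in B, ENNReal.ofReal (M t ω / max (M t ω) 1) ∂P)) := by
    refine tendsto_lintegral_of_dominated_convergence (fun _ => 1)
      (fun n => hg.measurable.comp (h.measurable _))
      (fun n => ae_of_all _ fun ω => ?_) ?_ (ae_of_all _ fun ω =>
        (hg.tendsto _).comp (((h.cont ω).tendsto t).comp hrlim))
    · rw [← ENNReal.ofReal_one]
      exact ENNReal.ofReal_le_ofReal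
        ((div_le_one (lt_max_of_lt_right one_pos)).2 (le_max_left _ _))
    · rw [lintegral_const, one_mul]
      exact measure_ne_top _ _
  refine tendsto_nhds_unique hlim1 (hlim2.congr fun n => ?_)
  exact (h.measure_inter_exists_ge hT (r n) (𝓕.mono (hrt n).le _ hB)).symm

/-- Almost surely, `γ ≤ t < T₀` means that `M` has not vanished at time `t` and never reaches `1`
afterwards: a path which lies above `1` after `t` crosses this level before vanishing. -/
lemma betweenEvent_ae_eq (h : IsLocalDensity P Q 𝓕 M) [IsFiniteMeasure P] [IsFiniteMeasure Q]
    (hT : ∀ᵐ ω ∂P, hitZero M ω < ⊤) (t : ℝ≥0) :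
    betweenEvent M t =ᵐ[P]
      ({ω | (t : WithTop ℝ≥0) < hitZero M ω} \ {ω | ∃ u, t < u ∧ 1 ≤ M u ω} : Set Ω) := by
  filter_upwards [hT, h.ae_lt_hitZero_iff] with ω hTω hpos
  refine propext ⟨fun hω => ⟨hω.2, ?_⟩, fun hω => ⟨sSup_le ?_, hω.1⟩⟩
  · rintro ⟨u, htu, hu⟩
    obtain ⟨r, hr⟩ := WithTop.ne_top_iff_exists.1 (ne_of_lt hTω)
    have hr0 : M r ω = 0 := mem_of_hittingAfter_eq_coe (h.cont ω) isClosed_singleton hr.symm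
    have hur : u ≤ r := by
      rw [← WithTop.coe_le_coe, hr]
      exact ((hpos u).2 (one_pos.trans_le hu)).le
    obtain ⟨w, hw, hw1⟩ := intermediate_value_Icc' hur (h.cont ω).continuousOn
      (show (1 : ℝ) ∈ Set.Icc (M r ω) (M u ω) from ⟨hr0 ▸ zero_le_one, hu⟩)
    have hw1' : M w ω = 1 := hw1
    have hmem : w ∈ {u : ℝ≥0 | (u : WithTop ℝ≥0) < hitZero M ω ∧ M u ω = 1} :=
      ⟨(hpos w).2 (hw1' ▸ one_pos), hw1'⟩
    have hle : (w : WithTop ℝ≥0) ≤ t := (le_sSup (Set.mem_image_of_mem _ hmem)).trans hω.1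
    exact (htu.trans_le hw.1).not_ge (WithTop.coe_le_coe.1 hle)
  · rintro _ ⟨u, hu, rfl⟩
    refine WithTop.coe_le_coe.2 (not_lt.1 fun htu => hω.2 ⟨u, htu, hu.2.ge⟩)

lemma nullMeasurableSet_betweenEvent (h : IsLocalDensity P Q 𝓕 M) [IsFiniteMeasure P]
    [IsFiniteMeasure Q] (hT : ∀ᵐ ω ∂P, hitZero M ω < ⊤) (t : ℝ≥0) :
    NullMeasurableSet (betweenEvent M t) P :=
  ((𝓕.le t _ (h.measurableSet_lt_hitZero t)).diff
    (h.measure_inter_exists_gt hT t).1).nullMeasurableSet.congr (h.betweenEvent_ae_eq hT t).symm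

lemma setLIntegral_recip_sub_one (h : IsLocalDensity P Q 𝓕 M) [IsFiniteMeasure P]
    [IsFiniteMeasure Q] (hT : ∀ᵐ ω ∂P, hitZero M ω < ⊤) (t : ℝ≥0) {B : Set Ω}
    (hB : MeasurableSet[𝓕 t] B) :
    ∫⁻ ω in B, ENNReal.ofReal (max (recipProcess M t ω - 1) 0) ∂Q =
      P (B ∩ betweenEvent M t) := by
  set D : Set Ω := {ω | (t : WithTop ℝ≥0) < hitZero M ω} with hD
  set G : Set Ω := {ω | ∃ u, t < u ∧ 1 ≤ M u ω} with hG
  have hDm : MeasurableSet[𝓕 t] D := h.measurableSet_lt_hitZero t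
  have hDm' := 𝓕.le t _ hDm
  have hB' := 𝓕.le t _ hB
  obtain ⟨hGm, hGP⟩ := h.measure_inter_exists_gt hT t
  have hg : Measurable[𝓕 t] fun ω => ENNReal.ofReal (max (recipProcess M t ω - 1) 0) :=
    (((h.measurable_recip t).sub_const 1).max measurable_const).ennreal_ofReal
  have hφ : Measurable fun ω => ENNReal.ofReal (M t ω / max (M t ω) 1) :=
    ((h.measurable t).div ((h.measurable t).max measurable_const)).ennreal_ofReal
  have hleft : ∫⁻ ω in B, ENNReal.ofReal (max (recipProcess M t ω - 1) 0) ∂Q =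
      ∫⁻ ω in B ∩ D, ENNReal.ofReal (M t ω) *
        ENNReal.ofReal (max (recipProcess M t ω - 1) 0) ∂P := by
    rw [h.setLIntegral_eq t hg hB, ← lintegral_inter_add_sdiff _ B hDm',
      setLIntegral_congr_fun (g := fun _ => 0) (hB'.diff hDm'), lintegral_zero, add_zero]
    intro ω hω
    simp [recipProcess_eq_zero hω.2]
  have hright : P (B ∩ betweenEvent M t) = P ((B ∩ D) \ G) := by
    rw [Set.inter_sdiff_assoc]
    exact measure_congr (ae_eq_set_inter (ae_eq_refl B) (h.betweenEvent_ae_eq hT t))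
  have hsum : ∫⁻ ω in B ∩ D, ENNReal.ofReal (M t ω) *
      ENNReal.ofReal (max (recipProcess M t ω - 1) 0) ∂P + P (B ∩ D ∩ G) = P (B ∩ D) := by
    rw [hGP _ (hB.inter hDm), ← lintegral_add_right _ hφ,
      setLIntegral_congr_fun (g := fun _ => 1) (hB'.inter hDm'), setLIntegral_one]
    intro ω hω
    have hM0 : M t ω ≠ 0 := (coe_lt_hitZero_iff (h.cont ω)).1 hω.2 t le_rfl
    have hMpos : 0 < M t ω := (h.nonneg t ω).lt_of_ne' hM0
    simp only
    rw [recipProcess_eq_of_lt hω.2, ← ENNReal.ofReal_mul hMpos.le,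
      ← ENNReal.ofReal_add (by positivity) (by positivity), ← ENNReal.ofReal_one]
    congr 1
    rcases le_total (M t ω) 1 with hle | hge
    · rw [max_eq_right hle, max_eq_left (sub_nonneg.2 (one_le_one_div hMpos hle))]
      field_simp
      ring
    · rw [max_eq_left hge, max_eq_right (sub_nonpos.2 ((div_le_one hMpos).2 hge)), mul_zero,
        zero_add, div_self hM0]
  rw [hleft, hright]
  refine (ENNReal.add_left_inj (measure_ne_top P (B ∩ D ∩ G))).1 ?_
  rw [hsum, add_comm, measure_inter_add_sdiff _ hGm]

/-- The measure with density `(M'_t - 1)^+` with respect to `Q` agrees on `𝓕 t` with the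
restriction of `P` to `{γ ≤ t < T₀}`. -/
lemma trim_withDensity_eq (h : IsLocalDensity P Q 𝓕 M) [IsFiniteMeasure P]
    [IsFiniteMeasure Q] (hT : ∀ᵐ ω ∂P, hitZero M ω < ⊤) (t : ℝ≥0) :
    (Q.withDensity fun ω => ENNReal.ofReal (max (recipProcess M t ω - 1) 0)).trim (𝓕.le t) =
      (P.restrict (betweenEvent M t)).trim (𝓕.le t) := by
  refine @Measure.ext _ (𝓕 t) _ _ fun A hA => ?_
  have hA' := 𝓕.le t _ hA
  rw [trim_measurableSet_eq _ hA, trim_measurableSet_eq _ hA, withDensity_apply _ hA',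
    Measure.restrict_apply hA', h.setLIntegral_recip_sub_one hT t hA]

lemma measurable_recip_sub_one (h : IsLocalDensity P Q 𝓕 M) (t : ℝ≥0) :
    Measurable fun ω => max (recipProcess M t ω - 1) 0 :=
  (((h.measurable_recip t).mono (𝓕.le t) le_rfl).sub_const 1).max measurable_const

lemma lintegral_mul_recip_sub_one (h : IsLocalDensity P Q 𝓕 M) [IsFiniteMeasure P]
    [IsFiniteMeasure Q] (hT : ∀ᵐ ω ∂P, hitZero M ω < ⊤) (t : ℝ≥0) {F : Ω → ℝ≥0∞}
    (hF : Measurable[𝓕 t] F) :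
    ∫⁻ ω, F ω * ENNReal.ofReal (max (recipProcess M t ω - 1) 0) ∂Q =
      ∫⁻ ω, F ω * (betweenEvent M t).indicator 1 ω ∂P := by
  have hF' : Measurable F := hF.mono (𝓕.le t) le_rfl
  have hg := (h.measurable_recip_sub_one t).ennreal_ofReal
  have hleft := lintegral_withDensity_eq_lintegral_mul Q hg hF'
  have hright := lintegral_indicator₀ (h.nullMeasurableSet_betweenEvent hT t) F
  calc _ = ∫⁻ ω, F ω ∂(Q.withDensity fun ω =>
        ENNReal.ofReal (max (recipProcess M t ω - 1) 0)) := by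
        rw [hleft]
        exact lintegral_congr fun ω => mul_comm _ _
    _ = ∫⁻ ω in betweenEvent M t, F ω ∂P := by
        rw [← lintegral_trim (𝓕.le t) hF, h.trim_withDensity_eq hT t,
          lintegral_trim (𝓕.le t) hF]
    _ = _ := by
        rw [← hright]
        refine lintegral_congr fun ω => ?_
        by_cases hω : ω ∈ betweenEvent M t <;> simp [hω]

lemma integral_mul_recip_sub_one (h : IsLocalDensity P Q 𝓕 M) [IsFiniteMeasure P]
    [IsFiniteMeasure Q] (hT : ∀ᵐ ω ∂P, hitZero M ω < ⊤) (t : ℝ≥0) {F : Ω → ℝ}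
    (hF : Measurable[𝓕 t] F) :
    ∫ ω, F ω * max (recipProcess M t ω - 1) 0 ∂Q =
      ∫ ω, F ω * (betweenEvent M t).indicator 1 ω ∂P := by
  have hg := (h.measurable_recip_sub_one t).ennreal_ofReal
  have hleft := integral_withDensity_eq_integral_toReal_smul (μ := Q) hg
    (ae_of_all _ fun _ => ENNReal.ofReal_lt_top) F
  have hright := integral_indicator₀ (f := F) (h.nullMeasurableSet_betweenEvent hT t)
  calc _ = ∫ ω, F ω ∂(Q.withDensity fun ω =>
        ENNReal.ofReal (max (recipProcess M t ω - 1) 0)) := by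
        rw [hleft]
        refine integral_congr_ae (ae_of_all _ fun ω => ?_)
        simp only [ENNReal.toReal_ofReal (le_max_right _ _), smul_eq_mul, mul_comm]
    _ = ∫ ω in betweenEvent M t, F ω ∂P := by
        rw [integral_trim (𝓕.le t) hF.stronglyMeasurable, h.trim_withDensity_eq hT t,
          ← integral_trim (𝓕.le t) hF.stronglyMeasurable]
    _ = _ := by
        rw [← hright]
        refine integral_congr_ae (ae_of_all _ fun ω => ?_)
        by_cases hω : ω ∈ betweenEvent M t <;> simp [hω]

lemma integrable_recip_sub_one (h : IsLocalDensity P Q 𝓕 M) [IsFiniteMeasure P]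
    [IsFiniteMeasure Q] (hT : ∀ᵐ ω ∂P, hitZero M ω < ⊤) (t : ℝ≥0) :
    Integrable (fun ω => max (recipProcess M t ω - 1) 0) Q := by
  refine (lintegral_ofReal_ne_top_iff_integrable
    (h.measurable_recip_sub_one t).aestronglyMeasurable
    (ae_of_all _ fun _ => le_max_right _ _)).1 ?_
  rw [← setLIntegral_univ, h.setLIntegral_recip_sub_one hT t MeasurableSet.univ]
  exact measure_ne_top _ _

end IsLocalDensity

end StrictLocal

theorem mainTheorem12 {Ω : Type*} {mΩ : MeasurableSpace Ω}
    (P Q : Measure Ω) [IsProbabilityMeasure P] [IsProbabilityMeasure Q]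
    (𝓕 : Filtration ℝ≥0 mΩ) (M : ℝ≥0 → Ω → ℝ)
    (hM : Martingale M 𝓕 P)
    (hM_cont : ∀ ω, Continuous fun t => M t ω)
    (hM_nonneg : ∀ t ω, 0 ≤ M t ω)
    (hM_zero : ∀ᵐ ω ∂P, M 0 ω = 1)
    (hQ : ∀ (t : ℝ≥0) (A : Set Ω), MeasurableSet[𝓕 t] A →
      Q A = ∫⁻ ω in A, ENNReal.ofReal (M t ω) ∂P)
    (hT : ∀ᵐ ω ∂P, StrictLocal.hitZero M ω < ⊤) :
    (∀ᵐ ω ∂Q, ∀ t, 0 < M t ω ∧ 0 < StrictLocal.recipProcess M t ω) ∧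
    StrictLocal.ClassLZeroPlus (StrictLocal.recipProcess M) 𝓕 Q ∧
    StrictLocal.IsStrictLocalMartingale (StrictLocal.recipProcess M) 𝓕 Q ∧
    (∀ (t : ℝ≥0) (F : Ω → ℝ), Measurable[𝓕 t] F → (∃ C : ℝ, ∀ ω, |F ω| ≤ C) →
      Integrable (fun ω => F ω * max (StrictLocal.recipProcess M t ω - 1) 0) Q ∧
      Integrable (fun ω => F ω * (StrictLocal.betweenEvent M t).indicator 1 ω) P ∧
      ∫ ω, F ω * max (StrictLocal.recipProcess M t ω - 1) 0 ∂Q =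
        ∫ ω, F ω * (StrictLocal.betweenEvent M t).indicator 1 ω ∂P) ∧
    (∀ (t : ℝ≥0) (F : Ω → ℝ≥0∞), Measurable[𝓕 t] F →
      ∫⁻ ω, F ω * ENNReal.ofReal (max (StrictLocal.recipProcess M t ω - 1) 0) ∂Q =
        ∫⁻ ω, F ω * (StrictLocal.betweenEvent M t).indicator 1 ω ∂P) := by
  have h : StrictLocal.IsLocalDensity P Q 𝓕 M := ⟨hM.1, hM_cont, hM_nonneg, hQ⟩
  refine ⟨?_, h.classLZeroPlus_recip hM_zero hT,
    ⟨h.isLocalMartingale_recip, h.not_martingale_recip hM_zero hT⟩,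
    fun t F hF hbdd => ?_, fun t F hF => h.lintegral_mul_recip_sub_one hT t hF⟩
  · filter_upwards [h.ae_forall_pos, h.ae_hitZero_eq_top] with ω hpos htop t
    rw [StrictLocal.recipProcess_eq_of_hitZero_eq_top htop]
    exact ⟨hpos t, one_div_pos.2 (hpos t)⟩
  · obtain ⟨C, hC⟩ := hbdd
    have hF' : Measurable F := hF.mono (𝓕.le t) le_rfl
    refine ⟨(h.integrable_recip_sub_one hT t).bdd_mul hF'.aestronglyMeasurable
      (ae_of_all _ hC), ?_, h.integral_mul_recip_sub_one hT t hF⟩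
    refine Integrable.bdd_mul ?_ hF'.aestronglyMeasurable (ae_of_all _ hC)
    exact (integrable_const (1 : ℝ)).indicator₀ (h.nullMeasurableSet_betweenEvent hT t)
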